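/- Let $0<a<2\pi$ and $\frac{\pi}{2}<\alpha\le\pi$. For $\rho>0$ put $$R(\rho)=\left(\frac{\rho}{a}\right)^{\frac{\pi}{2\alpha}}+\left(\frac{\rho}{a}\right)^{-\frac{\pi}{2\alpha}},$$ and for $k\in\mathbb{C}$ define $\kappa$ by $k=-\frac{\pi}{2\alpha}\kappa$. For $-\alpha<\varphi<\alpha$ and $\rho>a$ let $$\begin{aligned} F_3(\varphi,k)=&-k\int_{-\alpha}^{\alpha}\sin(k\theta)\ln\left|\sin\left(\frac{\pi\varphi}{2\alpha}\right)+\sin\left(\frac{\pi\theta}{2\alpha}\right)\right|d\theta\\ &+k\cos(\alpha k)\int_a^\infty\left(\frac{r}{a}\right)^k\ln\left|\frac{R(r)+2\sin\left(\frac{\pi\varphi}{2\alpha}\right)}{R(r)-2\sin\left(\frac{\pi\varphi}{2\alpha}\right)}\right|\frac{dr}{r}-\pi\sin(k\varphi),\\ F_4(\rho,k)=&\;k\int_{-\alpha}^{\alpha}\sin(k\theta)\ln\left|\frac{R(\rho)}{2}+\sin\left(\frac{\pi\theta}{2\alpha}\right)\right|d\theta\\ &+k\cos(\alpha k)\int_a^\infty\left(\frac{r}{a}\right)^k\ln\left|\frac{R(r)-R(\rho)}{R(r)+R(\rho)}\right|\frac{dr}{r}+\pi\sin(\alpha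 k)\left(\frac{\rho}{a}\right)^k. \end{aligned}$$ If $\operatorname{Re}\kappa>-1$ (equivalently $\operatorname{Re}k<\frac{\pi}{2\alpha}$), then all four integrals converge absolutely, and $$F_3(\varphi,k)=0\quad\text{for all }-\alpha<\varphi<\alpha,\qquad F_4(\rho,k)=0\quad\text{for all }\rho>a.$$ -/

import Mathlib

open MeasureTheory

noncomputable section

/-- `R(ρ) = (ρ/a)^(π/(2α)) + (ρ/a)^(-π/(2α))`. -/
def wedgeR (a α ρ : ℝ) : ℝ :=
  (ρ / a) ^ (Real.pi / (2 * α)) + (ρ / a) ^ (-(Real.pi / (2 * α)))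

/-- The variable `κ` attached to `k`, i.e. `k = -(π/(2α)) κ`. -/
def kappaOf (α : ℝ) (k : ℂ) : ℂ :=
  -((2 * α / Real.pi : ℝ) : ℂ) * k

/-- `sin(kθ) ln|sin(πφ/(2α)) + sin(πθ/(2α))|`, as a function of `θ`. -/
def F3ArcIntegrand (α φ : ℝ) (k : ℂ) (θ : ℝ) : ℂ :=
  Complex.sin (k * θ) *
    (Real.log |Real.sin (Real.pi * φ / (2 * α)) + Real.sin (Real.pi * θ / (2 * α))| : ℝ)

/-- `(r/a)^k ln|(R(r) + 2 sin(πφ/(2α))) / (R(r) - 2 sin(πφ/(2α)))| / r`, as a function of `r`. -/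
def F3RayIntegrand (a α φ : ℝ) (k : ℂ) (r : ℝ) : ℂ :=
  ((r / a : ℝ) : ℂ) ^ k *
    (Real.log |(wedgeR a α r + 2 * Real.sin (Real.pi * φ / (2 * α))) /
      (wedgeR a α r - 2 * Real.sin (Real.pi * φ / (2 * α)))| : ℝ) / (r : ℂ)

/-- `sin(kθ) ln|R(ρ)/2 + sin(πθ/(2α))|`, as a function of `θ`. -/
def F4ArcIntegrand (a α ρ : ℝ) (k : ℂ) (θ : ℝ) : ℂ :=
  Complex.sin (k * θ) *
    (Real.log |wedgeR a α ρ / 2 + Real.sin (Real.pi * θ / (2 * α))| : ℝ)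

/-- `(r/a)^k ln|(R(r) - R(ρ)) / (R(r) + R(ρ))| / r`, as a function of `r`. -/
def F4RayIntegrand (a α ρ : ℝ) (k : ℂ) (r : ℝ) : ℂ :=
  ((r / a : ℝ) : ℂ) ^ k *
    (Real.log |(wedgeR a α r - wedgeR a α ρ) / (wedgeR a α r + wedgeR a α ρ)| : ℝ) / (r : ℂ)

/-- The function `F₃(φ, k)`. -/
def F3 (a α φ : ℝ) (k : ℂ) : ℂ :=
  -k * (∫ θ in (-α)..α, F3ArcIntegrand α φ k θ)
    + k * Complex.cos (α * k) * (∫ r in Set.Ioi a, F3RayIntegrand a α φ k r)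
    - Real.pi * Complex.sin (k * φ)

/-- The function `F₄(ρ, k)`. -/
def F4 (a α ρ : ℝ) (k : ℂ) : ℂ :=
  k * (∫ θ in (-α)..α, F4ArcIntegrand a α ρ k θ)
    + k * Complex.cos (α * k) * (∫ r in Set.Ioi a, F4RayIntegrand a α ρ k r)
    + Real.pi * Complex.sin (α * k) * ((ρ / a : ℝ) : ℂ) ^ k

end

open MeasureTheory

/-! Put `b = 2α/π` and `l = b k`; the hypothesis on `κ` says `Re l < 1`. The substitutions `θ = b x`
and `r = a exp (b t)` turn `R(r)` into `2 cosh t`, and both formulas become instances of one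
identity with a real parameter `c`: `c = sin y` for `F3` and `c = cosh s` for `F4`.

That identity, `strip_identity`, is Cauchy's theorem for `exp (l w) (log (sinh w + i c) - log (sinh
w - i c))` on the half strip `Re w ≥ 0`, `|Im w| ≤ π/2`. There `sinh` takes values in the closed
right half-plane and sends the boundary to the imaginary axis, where the principal logarithm of `i
u` is `log |u| + i (π/2) sign u`. The moduli yield the ray and arc integrals; the signs yield
elementary exponential integrals, which become the explicit sine terms.

Two limits are needed. The branch points lie on the boundary, so the logarithms are first shifted by
`d > 0` and then `d → 0` by dominated convergence (`tendsto_integral_exp_mul_log_sinh`). The strip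
is cut at `Re w = T`, and the far edge vanishes because the difference of logarithms is `O(exp
(-T))` (`norm_clog_add_sub_le`, `tendsto_integral_right_edge`); this is where `Re l < 1` enters. -/

/-! ### Logarithmic singularities of `log (sinh w + c)` along lines. -/

lemma analyticAt_sinh_line (c w₀ v : ℂ) (t : ℝ) :
    AnalyticAt ℝ (fun t : ℝ => Complex.sinh (w₀ + t * v) + c) t := by
  have h1 : AnalyticAt ℂ (fun z : ℂ => Complex.sinh (w₀ + z * v) + c) (t : ℂ) := by fun_prop
  exact (h1.restrictScalars (𝕜 := ℝ)).comp (f := fun t : ℝ => (t : ℂ))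
    (Complex.ofRealCLM.analyticAt t)

open Filter in
/-- A shifted path under `sinh` avoids any given value almost everywhere. -/
lemma ae_sinh_line_ne (c w₀ v : ℂ) (hv : v ≠ 0) :
    ∀ᵐ t : ℝ, Complex.sinh (w₀ + t * v) + c ≠ 0 := by
  have han : AnalyticOnNhd ℝ (fun t : ℝ => Complex.sinh (w₀ + t * v) + c) Set.univ :=
    fun t _ => analyticAt_sinh_line c w₀ v t
  obtain ⟨x, hx⟩ : ∃ x : ℝ, Complex.sinh (w₀ + x * v) + c ≠ 0 := by
    -- If the function vanished identically, two differentiations would give `cosh = sinh = 0` at a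
    -- point, against `cosh² - sinh² = 1`.
    by_contra! h
    have hl : ∀ t : ℝ, HasDerivAt (fun t : ℝ => w₀ + (t : ℂ) * v) v t := fun t => by
      simpa using ((Complex.ofRealCLM.hasDerivAt (x := t)).mul_const v).const_add w₀
    have h1 : ∀ t : ℝ, Complex.cosh (w₀ + t * v) * v = 0 := fun t => by
      have hd := ((Complex.hasDerivAt_sinh (w₀ + t * v)).comp t (hl t)).add_const c
      have h0 : (fun t : ℝ => (Complex.sinh ∘ fun t : ℝ => w₀ + (t : ℂ) * v) t + c)
        = fun _ => 0 := funext h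
      rw [h0] at hd
      exact hd.unique (hasDerivAt_const _ _)
    have h2 : ∀ t : ℝ, Complex.sinh (w₀ + t * v) * v * v = 0 := fun t => by
      have hd := ((Complex.hasDerivAt_cosh (w₀ + t * v)).comp t (hl t)).mul_const v
      have h0 : (fun t : ℝ => (Complex.cosh ∘ fun t : ℝ => w₀ + (t : ℂ) * v) t * v)
        = fun _ => 0 := funext h1
      rw [h0] at hd
      exact hd.unique (hasDerivAt_const _ _)
    have e1 := h1 0
    have e2 := h2 0
    simp only [mul_eq_zero, hv, or_false] at e1 e2
    have := Complex.cosh_sq_sub_sinh_sq (w₀ + ((0 : ℝ) : ℂ) * v)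
    rw [e1, e2] at this
    simp at this
  have := han.preimage_zero_mem_codiscrete hx
  have h2 : {t : ℝ | Complex.sinh (w₀ + t * v) + c ≠ 0} ∈ codiscreteWithin (Set.univ : Set ℝ) := this
  have h3 := ae_restrict_le_codiscreteWithin (μ := volume) MeasurableSet.univ h2
  rw [Measure.restrict_univ] at h3
  exact h3

lemma intervalIntegrable_log_norm_sinh_line (c w₀ v : ℂ) (a b : ℝ) :
    IntervalIntegrable (fun t : ℝ => Real.log ‖Complex.sinh (w₀ + t * v) + c‖) volume a b :=
  MeromorphicOn.intervalIntegrable_log_norm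
    fun t _ => (analyticAt_sinh_line c w₀ v t).meromorphicAt

lemma norm_complex_log_le (z : ℂ) : ‖Complex.log z‖ ≤ |Real.log ‖z‖| + Real.pi := by
  refine (Complex.norm_le_abs_re_add_abs_im _).trans ?_
  rw [Complex.log_re, Complex.log_im]
  gcongr
  exact Complex.abs_arg_le_pi z

/-- The integrand `exp (l w) log (sinh w + c)` is integrable along every segment. -/
lemma intervalIntegrable_exp_mul_log_sinh (l c w₀ v : ℂ) (a b : ℝ) :
    IntervalIntegrable (fun t : ℝ => Complex.exp (l * (w₀ + t * v)) *
      Complex.log (Complex.sinh (w₀ + t * v) + c)) volume a b := by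
  refine IntervalIntegrable.continuousOn_mul ?_ (by fun_prop)
  refine (((intervalIntegrable_log_norm_sinh_line c w₀ v a b).abs.add
    (intervalIntegrable_const (c := Real.pi)))).mono_fun ?_ ?_
  · have : Measurable fun t : ℝ => Complex.log (Complex.sinh (w₀ + t * v) + c) := by fun_prop
    exact this.aestronglyMeasurable
  · refine ae_of_all _ fun t => (norm_complex_log_le _).trans (le_abs_self _)

/-- Uniform bound for logarithms shifted into the right half-plane. -/
lemma norm_log_add_le {z : ℂ} (hz : 0 ≤ z.re) (hz0 : z ≠ 0) {d : ℝ} (hd : 0 < d) (hd1 : d ≤ 1) :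
    ‖Complex.log (z + d)‖ ≤ |Real.log ‖z‖| + ‖z‖ + Real.pi := by
  refine (norm_complex_log_le _).trans ?_
  have hzpos : 0 < ‖z‖ := norm_pos_iff.2 hz0
  have h1 : ‖z‖ ≤ ‖z + d‖ := by
    rw [Complex.norm_def, Complex.norm_def]
    apply Real.sqrt_le_sqrt
    simp only [Complex.normSq_apply, Complex.add_re, Complex.add_im, Complex.ofReal_re,
      Complex.ofReal_im, add_zero]
    nlinarith
  have h2 : ‖z + d‖ ≤ ‖z‖ + 1 := by
    refine (norm_add_le _ _).trans ?_
    rw [Complex.norm_real, Real.norm_of_nonneg hd.le]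
    linarith
  have h3 := Real.log_le_log hzpos h1
  have h4 : Real.log ‖z + d‖ ≤ ‖z‖ := by
    have := Real.log_le_sub_one_of_pos (hzpos.trans_le h1)
    linarith
  have h5 : |Real.log ‖z + d‖| ≤ |Real.log ‖z‖| + ‖z‖ := by
    rw [abs_le]
    constructor
    · linarith [neg_abs_le (Real.log ‖z‖)]
    · linarith [abs_nonneg (Real.log ‖z‖)]
  linarith

open Filter Topology in
-- Removes the shift `d`. Nonnegative real part gives a dominating function independent of `d`, and
-- it keeps the unshifted argument, where nonzero, off the branch cut.
lemma tendsto_integral_exp_mul_log_sinh (l c w₀ v : ℂ) (hv : v ≠ 0) (a b : ℝ)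
    (hre : ∀ t ∈ Set.uIoc a b, 0 ≤ (Complex.sinh (w₀ + t * v) + c).re) :
    Tendsto (fun d : ℝ => ∫ t in a..b, Complex.exp (l * (w₀ + t * v)) *
      Complex.log (Complex.sinh (w₀ + t * v) + c + d)) (𝓝[>] 0)
      (𝓝 (∫ t in a..b, Complex.exp (l * (w₀ + t * v)) *
      Complex.log (Complex.sinh (w₀ + t * v) + c))) := by
  have hne := ae_sinh_line_ne c w₀ v hv
  refine intervalIntegral.tendsto_integral_filter_of_dominated_convergence
    (fun t : ℝ => ‖Complex.exp (l * (w₀ + t * v))‖ *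
      (|Real.log ‖Complex.sinh (w₀ + t * v) + c‖| + ‖Complex.sinh (w₀ + t * v) + c‖ + Real.pi))
    ?_ ?_ ?_ ?_
  · refine Eventually.of_forall fun d => ?_
    have : Measurable fun t : ℝ => Complex.exp (l * (w₀ + t * v)) *
      Complex.log (Complex.sinh (w₀ + t * v) + c + d) := by fun_prop
    exact this.aestronglyMeasurable
  · filter_upwards [Ioc_mem_nhdsGT (zero_lt_one' ℝ)] with d hd
    filter_upwards [hne] with t ht hmem
    rw [norm_mul]
    gcongr
    exact norm_log_add_le (hre t hmem) ht hd.1 hd.2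
  · refine IntervalIntegrable.continuousOn_mul ?_ (by fun_prop)
    refine ((intervalIntegrable_log_norm_sinh_line c w₀ v a b).abs.add ?_).add
      intervalIntegrable_const
    apply Continuous.intervalIntegrable
    fun_prop
  · filter_upwards [hne] with t ht hmem
    have hslit : Complex.sinh (w₀ + t * v) + c ∈ Complex.slitPlane := by
      rw [Complex.mem_slitPlane_iff]
      by_contra! h
      exact ht (Complex.ext (le_antisymm h.1 (hre t hmem)) h.2)
    refine Tendsto.const_mul _ ?_
    have hc : Tendsto (fun d : ℝ => Complex.sinh (w₀ + t * v) + c + d) (𝓝[>] 0)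
        (𝓝 (Complex.sinh (w₀ + t * v) + c)) := by
      have : Continuous fun d : ℝ => Complex.sinh (w₀ + t * v) + c + (d : ℂ) := by fun_prop
      simpa using (this.tendsto 0).mono_left nhdsWithin_le_nhds
    exact hc.clog hslit

/-! ### Cauchy's theorem on a truncated half strip. -/

lemma sinh_re_nonneg {w : ℂ} (h0 : 0 ≤ w.re) (h1 : -(Real.pi / 2) ≤ w.im)
    (h2 : w.im ≤ Real.pi / 2) : 0 ≤ (Complex.sinh w).re := by
  have : (Complex.sinh w).re = Real.sinh w.re * Real.cos w.im := by
    conv_lhs => rw [← Complex.re_add_im w]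
    rw [Complex.sinh_add, Complex.cosh_mul_I, Complex.sinh_mul_I]
    simp [← Complex.ofReal_sinh, ← Complex.ofReal_cosh, ← Complex.ofReal_sin, ← Complex.ofReal_cos]
  rw [this]
  exact mul_nonneg (Real.sinh_nonneg_iff.2 h0) (Real.cos_nonneg_of_mem_Icc ⟨h1, h2⟩)

lemma sinh_add_mul_I_re_nonneg (c : ℝ) {w : ℂ} (h0 : 0 ≤ w.re) (h1 : -(Real.pi / 2) ≤ w.im)
    (h2 : w.im ≤ Real.pi / 2) : 0 ≤ (Complex.sinh w + c * Complex.I).re := by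
  simpa using sinh_re_nonneg h0 h1 h2

/-- Cauchy's theorem for `exp (l w) log (sinh w + i c)` on a rectangle in the half strip with the
branch points moved off by `d`. -/
lemma integral_boundary_rect_exp_mul_log_sinh_add (l : ℂ) (c : ℝ) {T : ℝ} (hT : 0 ≤ T) {d : ℝ} (hd : 0 < d) :
    (∫ t in (0:ℝ)..T, Complex.exp (l * (((-(Real.pi / 2) : ℝ) : ℂ) * Complex.I + t * 1)) *
        Complex.log (Complex.sinh (((-(Real.pi / 2) : ℝ) : ℂ) * Complex.I + t * 1)
          + c * Complex.I + d))
    - (∫ t in (0:ℝ)..T, Complex.exp (l * (((Real.pi / 2 : ℝ) : ℂ) * Complex.I + t * 1)) *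
        Complex.log (Complex.sinh (((Real.pi / 2 : ℝ) : ℂ) * Complex.I + t * 1) + c * Complex.I + d))
    + Complex.I * (∫ y in (-(Real.pi / 2))..(Real.pi / 2),
        Complex.exp (l * ((T : ℂ) + y * Complex.I)) *
        Complex.log (Complex.sinh ((T : ℂ) + y * Complex.I) + c * Complex.I + d))
    - Complex.I * (∫ y in (-(Real.pi / 2))..(Real.pi / 2),
        Complex.exp (l * (((0 : ℝ) : ℂ) + y * Complex.I)) *
        Complex.log (Complex.sinh (((0 : ℝ) : ℂ) + y * Complex.I) + c * Complex.I + d)) = 0 := by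
  have hpi := Real.pi_pos
  have hle : -(Real.pi / 2) ≤ Real.pi / 2 := by linarith
  have key := Complex.integral_boundary_rect_eq_zero_of_differentiableOn
    (fun w => Complex.exp (l * w) * Complex.log (Complex.sinh w + c * Complex.I + d))
    ⟨0, -(Real.pi / 2)⟩ ⟨T, Real.pi / 2⟩ (by
      intro w hw
      rw [Complex.mem_reProdIm, Set.uIcc_of_le hT, Set.uIcc_of_le hle] at hw
      have hs : Complex.sinh w + c * Complex.I + d ∈ Complex.slitPlane := by
        refine Or.inl ?_
        have := sinh_add_mul_I_re_nonneg c hw.1.1 hw.2.1 hw.2.2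
        rw [Complex.add_re, Complex.ofReal_re]
        linarith
      refine DifferentiableAt.differentiableWithinAt ?_
      exact (by fun_prop : DifferentiableAt ℂ (fun w => Complex.exp (l * w)) w).mul
        (DifferentiableAt.clog (by fun_prop) hs))
  have h1 : ∀ x : ℝ, (x : ℂ) + ((-(Real.pi / 2) : ℝ) : ℂ) * Complex.I
      = ((-(Real.pi / 2) : ℝ) : ℂ) * Complex.I + x * 1 := fun x => by ring
  have h2 : ∀ x : ℝ, (x : ℂ) + ((Real.pi / 2 : ℝ) : ℂ) * Complex.I
      = ((Real.pi / 2 : ℝ) : ℂ) * Complex.I + x * 1 := fun x => by ring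
  simp only [smul_eq_mul, h1, h2] at key
  exact key

/-- Cauchy's theorem for `exp (l w) log (sinh w + i c)` on a rectangle in the half strip whose
boundary carries the branch points. -/
lemma integral_boundary_rect_exp_mul_log_sinh (l : ℂ) (c : ℝ) {T : ℝ} (hT : 0 ≤ T) :
    (∫ t in (0:ℝ)..T, Complex.exp (l * (((-(Real.pi / 2) : ℝ) : ℂ) * Complex.I + t * 1)) *
        Complex.log (Complex.sinh (((-(Real.pi / 2) : ℝ) : ℂ) * Complex.I + t * 1)
          + c * Complex.I))
    - (∫ t in (0:ℝ)..T, Complex.exp (l * (((Real.pi / 2 : ℝ) : ℂ) * Complex.I + t * 1)) *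
        Complex.log (Complex.sinh (((Real.pi / 2 : ℝ) : ℂ) * Complex.I + t * 1) + c * Complex.I))
    + Complex.I * (∫ y in (-(Real.pi / 2))..(Real.pi / 2),
        Complex.exp (l * ((T : ℂ) + y * Complex.I)) *
        Complex.log (Complex.sinh ((T : ℂ) + y * Complex.I) + c * Complex.I))
    - Complex.I * (∫ y in (-(Real.pi / 2))..(Real.pi / 2),
        Complex.exp (l * (((0 : ℝ) : ℂ) + y * Complex.I)) *
        Complex.log (Complex.sinh (((0 : ℝ) : ℂ) + y * Complex.I) + c * Complex.I)) = 0 := by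
  have hpi := Real.pi_pos
  have hle : -(Real.pi / 2) ≤ Real.pi / 2 := by linarith
  have e1 := tendsto_integral_exp_mul_log_sinh l (c * Complex.I)
    (((-(Real.pi / 2) : ℝ) : ℂ) * Complex.I) 1 one_ne_zero 0 T (by
      intro t ht
      rw [Set.uIoc_of_le hT] at ht
      apply sinh_add_mul_I_re_nonneg <;> simp <;> linarith [ht.1])
  have e2 := tendsto_integral_exp_mul_log_sinh l (c * Complex.I)
    (((Real.pi / 2 : ℝ) : ℂ) * Complex.I) 1 one_ne_zero 0 T (by
      intro t ht
      rw [Set.uIoc_of_le hT] at ht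
      apply sinh_add_mul_I_re_nonneg <;> simp <;> linarith [ht.1])
  have hv : ∀ S : ℝ, 0 ≤ S → ∀ t ∈ Set.uIoc (-(Real.pi / 2)) (Real.pi / 2),
      0 ≤ (Complex.sinh ((S : ℂ) + t * Complex.I) + c * Complex.I).re := by
    intro S hS t ht
    rw [Set.uIoc_of_le hle] at ht
    apply sinh_add_mul_I_re_nonneg <;> simp <;> linarith [ht.1, ht.2]
  have e3 := tendsto_integral_exp_mul_log_sinh l
    (c * Complex.I) (T : ℂ) Complex.I Complex.I_ne_zero _ _ (hv T hT)
  have e4 := tendsto_integral_exp_mul_log_sinh l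
    (c * Complex.I) ((0 : ℝ) : ℂ) Complex.I Complex.I_ne_zero _ _ (hv 0 le_rfl)
  have hlim := ((e1.sub e2).add (e3.const_mul Complex.I)).sub (e4.const_mul Complex.I)
  refine tendsto_nhds_unique (hlim.congr' ?_) tendsto_const_nhds
  filter_upwards [self_mem_nhdsWithin] with d hd
  exact integral_boundary_rect_exp_mul_log_sinh_add l c hT hd

/-! ### Decay of the difference of logarithms, and boundary values. -/

/-- Mean value inequality on the ball of radius `|c|` about `z`: there the derivative of `log` is at
most `2 / ‖z‖`, and the two points are `2 |c|` apart. -/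
lemma norm_clog_add_sub_le {z : ℂ} (hz : 0 ≤ z.re) {c : ℝ} (hc : 2 * |c| ≤ ‖z‖) :
    ‖Complex.log (z + c * Complex.I) - Complex.log (z + (-c : ℝ) * Complex.I)‖
      ≤ 4 * |c| / ‖z‖ := by
  rcases eq_or_ne z 0 with rfl | hz0
  · have : c = 0 := by
      rw [← abs_eq_zero]
      refine le_antisymm ?_ (abs_nonneg c)
      rw [norm_zero] at hc
      linarith
    simp [this]
  have hpos : 0 < ‖z‖ := norm_pos_iff.2 hz0
  have hball : ∀ w ∈ Metric.closedBall z |c|, ‖z‖ / 2 ≤ ‖w‖ ∧ w ∈ Complex.slitPlane := by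
    intro w hw
    rw [mem_closedBall_iff_norm] at hw
    constructor
    · have := norm_sub_norm_le z w
      rw [norm_sub_rev] at this
      linarith
    · rw [Complex.mem_slitPlane_iff_not_le_zero]
      intro hw0
      obtain ⟨h1, h2⟩ := Complex.le_def.1 hw0
      simp only [Complex.zero_re, Complex.zero_im] at h1 h2
      -- Since `Re z ≥ 0`, every point of the cut is at distance at least `‖z‖` from `z`, so the
      -- ball misses it.
      have : ‖z‖ ≤ ‖w - z‖ := by
        rw [Complex.norm_def, Complex.norm_def]
        apply Real.sqrt_le_sqrt
        simp only [Complex.normSq_apply, Complex.sub_re, Complex.sub_im, h2]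
        nlinarith [mul_nonneg hz (neg_nonneg.2 h1), mul_self_nonneg w.re]
      linarith
  have hmem : ∀ s : ℝ, |s| = |c| → z + s * Complex.I ∈ Metric.closedBall z |c| := by
    intro s hs
    simp [hs]
  have := (convex_closedBall z |c|).norm_image_sub_le_of_norm_hasDerivWithin_le
    (f := Complex.log) (f' := fun w => w⁻¹) (C := 2 / ‖z‖)
    (fun w hw => (Complex.hasDerivAt_log (hball w hw).2).hasDerivWithinAt)
    (fun w hw => by
      rw [norm_inv, ← inv_div]
      exact inv_anti₀ (by positivity) (hball w hw).1)
    (hmem (-c) (abs_neg c)) (hmem c rfl)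
  refine this.trans (le_of_eq ?_)
  have : z + c * Complex.I - (z + (-c : ℝ) * Complex.I) = ((2 * c : ℝ) : ℂ) * Complex.I := by
    push_cast; ring
  rw [this, norm_mul, Complex.norm_I, Complex.norm_real, Real.norm_eq_abs, abs_mul, abs_two]
  ring

/-- The principal logarithm on the imaginary axis. -/
lemma clog_I_mul (u : ℝ) : Complex.log (Complex.I * u)
    = (Real.log |u| : ℝ) + ((Real.pi / 2 * Real.sign u : ℝ) : ℂ) * Complex.I := by
  rcases lt_trichotomy u 0 with h | h | h
  · have : Complex.arg (Complex.I * u) = -(Real.pi / 2) := by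
      rw [Complex.arg_eq_neg_pi_div_two_iff]
      simpa using h
    rw [Complex.log, this, Real.sign_of_neg h]
    simp
  · simp [h]
  · have : Complex.arg (Complex.I * u) = Real.pi / 2 := by
      rw [Complex.arg_eq_pi_div_two_iff]
      simpa using h
    rw [Complex.log, this, Real.sign_of_pos h]
    simp

/-- `log |(cosh t + c) / (cosh t - c)|`, away from the zeros. -/
noncomputable def coshLogDiff (c t : ℝ) : ℝ := Real.log |Real.cosh t + c| - Real.log |Real.cosh t - c|

/-- The jump `sign (cosh t + c) - sign (cosh t - c)` of the argument, in units of `π / 2`. -/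
noncomputable def coshSignDiff (c t : ℝ) : ℝ := Real.sign (Real.cosh t + c) - Real.sign (Real.cosh t - c)

lemma measurable_real_sign : Measurable Real.sign := by
  unfold Real.sign
  exact Measurable.ite measurableSet_Iio measurable_const
    (Measurable.ite measurableSet_Ioi measurable_const measurable_const)

lemma abs_real_sign_le (u : ℝ) : |Real.sign u| ≤ 1 := by
  rcases Real.sign_apply_eq u with h | h | h <;> simp [h]

lemma sinh_neg_pi_div_two_add (t : ℝ) :
    Complex.sinh (((-(Real.pi / 2) : ℝ) : ℂ) * Complex.I + t * 1)
      = Complex.I * ((-Real.cosh t : ℝ) : ℂ) := by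
  rw [mul_one, Complex.sinh_add, Complex.sinh_mul_I, Complex.cosh_mul_I, ← Complex.ofReal_sin,
    ← Complex.ofReal_cos, Real.sin_neg, Real.cos_neg, Real.cos_pi_div_two, Real.sin_pi_div_two]
  push_cast; ring

lemma sinh_pi_div_two_add (t : ℝ) :
    Complex.sinh (((Real.pi / 2 : ℝ) : ℂ) * Complex.I + t * 1)
      = Complex.I * ((Real.cosh t : ℝ) : ℂ) := by
  rw [mul_one, Complex.sinh_add, Complex.sinh_mul_I, Complex.cosh_mul_I, ← Complex.ofReal_sin,
    ← Complex.ofReal_cos, Real.cos_pi_div_two, Real.sin_pi_div_two]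
  push_cast; ring

lemma sinh_zero_add_mul_I (y : ℝ) :
    Complex.sinh (((0 : ℝ) : ℂ) + y * Complex.I) = Complex.I * ((Real.sin y : ℝ) : ℂ) := by
  rw [Complex.ofReal_zero, zero_add, Complex.sinh_mul_I]
  push_cast; ring

lemma exp_le_two_mul_cosh (t : ℝ) : Real.exp t ≤ 2 * Real.cosh t := by
  rw [Real.cosh_eq]
  linarith [Real.exp_pos (-t)]

/-- The real part of `norm_clog_add_sub_le` at `z = i cosh t`, combined with `exp t ≤ 2 cosh t`. -/
lemma abs_coshLogDiff_le {c t : ℝ} (h : 4 * |c| ≤ Real.exp t) :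
    |coshLogDiff c t| ≤ 8 * |c| * Real.exp (-t) := by
  have hcosh := exp_le_two_mul_cosh t
  have hpos := Real.cosh_pos t
  have hn : ‖Complex.I * ((Real.cosh t : ℝ) : ℂ)‖ = Real.cosh t := by
    rw [norm_mul, Complex.norm_I, Complex.norm_real, Real.norm_of_nonneg hpos.le, one_mul]
  have key := norm_clog_add_sub_le (z := Complex.I * ((Real.cosh t : ℝ) : ℂ)) (c := c)
    (by simp) (by rw [hn]; linarith)
  have e : ∀ s : ℝ, Complex.I * ((Real.cosh t : ℝ) : ℂ) + s * Complex.I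
      = Complex.I * ((Real.cosh t + s : ℝ) : ℂ) := fun s => by push_cast; ring
  rw [e, e, hn] at key
  have h2 : coshLogDiff c t = (Complex.log (Complex.I * ((Real.cosh t + c : ℝ) : ℂ))
      - Complex.log (Complex.I * ((Real.cosh t + -c : ℝ) : ℂ))).re := by
    rw [clog_I_mul, clog_I_mul]
    simp [coshLogDiff, sub_eq_add_neg]
  rw [h2]
  refine ((Complex.abs_re_le_norm _).trans key).trans ?_
  rw [Real.exp_neg, div_le_iff₀ hpos]
  have := Real.exp_pos t
  have h3 : 1 ≤ (Real.exp t)⁻¹ * (2 * Real.cosh t) := by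
    rw [inv_mul_eq_div, le_div_iff₀ this]; linarith
  nlinarith [abs_nonneg c]

lemma coshSignDiff_eq_zero {c t : ℝ} (h : |c| < Real.cosh t) : coshSignDiff c t = 0 := by
  rw [abs_lt] at h
  rw [coshSignDiff, Real.sign_of_pos (by linarith), Real.sign_of_pos (by linarith), sub_self]

/-! ### Integrability of the boundary terms. -/

lemma intervalIntegrable_log_abs_cosh (c a b : ℝ) :
    IntervalIntegrable (fun t => Real.log |Real.cosh t + c|) volume a b := by
  have h : AnalyticOnNhd ℝ (fun t => Real.cosh t + c) Set.univ := fun t _ => by fun_prop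
  exact MeromorphicOn.intervalIntegrable_log_norm (f := fun t => Real.cosh t + c)
    fun t _ => (h t trivial).meromorphicAt

lemma intervalIntegrable_log_abs_sin (c a b : ℝ) :
    IntervalIntegrable (fun t => Real.log |Real.sin t + c|) volume a b := by
  have h : AnalyticOnNhd ℝ (fun t => Real.sin t + c) Set.univ := fun t _ => by fun_prop
  exact MeromorphicOn.intervalIntegrable_log_norm (f := fun t => Real.sin t + c)
    fun t _ => (h t trivial).meromorphicAt

lemma intervalIntegrable_sign_comp {f : ℝ → ℝ} (hf : Measurable f) (a b : ℝ) :
    IntervalIntegrable (fun t => Real.sign (f t)) volume a b := by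
  refine (intervalIntegrable_const (c := (1 : ℝ))).mono_fun
    (measurable_real_sign.comp hf).aestronglyMeasurable (ae_of_all _ fun t => ?_)
  simpa using abs_real_sign_le (f t)

lemma intervalIntegrable_coshLogDiff (c a b : ℝ) :
    IntervalIntegrable (coshLogDiff c) volume a b := by
  have := (intervalIntegrable_log_abs_cosh c a b).sub (intervalIntegrable_log_abs_cosh (-c) a b)
  exact this

lemma intervalIntegrable_coshSignDiff (c a b : ℝ) :
    IntervalIntegrable (coshSignDiff c) volume a b :=
  (intervalIntegrable_sign_comp (by fun_prop) a b).sub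
    (intervalIntegrable_sign_comp (by fun_prop) a b)

/-- Multiplying a real interval integrable function by a continuous complex one. -/
lemma IntervalIntegrable.continuous_mul_ofReal {f : ℝ → ℝ} {g : ℝ → ℂ} {a b : ℝ}
    (hf : IntervalIntegrable f volume a b) (hg : Continuous g) :
    IntervalIntegrable (fun t => g t * (f t : ℂ)) volume a b :=
  IntervalIntegrable.continuousOn_mul (f := fun t => (f t : ℂ)) ⟨hf.1.ofReal, hf.2.ofReal⟩
    hg.continuousOn

lemma integrableOn_exp_mul_ofReal {l : ℂ} (hl : l.re < 1) {f : ℝ → ℝ} {C T : ℝ} (hT : 0 ≤ T)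
    (hf : IntervalIntegrable f volume 0 T) (hm : Measurable f)
    (hb : ∀ t, T < t → |f t| ≤ C * Real.exp (-t)) :
    IntegrableOn (fun t : ℝ => Complex.exp (l * t) * (f t : ℂ)) (Set.Ioi 0) := by
  rw [← Set.Ioc_union_Ioi_eq_Ioi hT]
  refine IntegrableOn.union ?_ ?_
  · exact (intervalIntegrable_iff_integrableOn_Ioc_of_le hT).1
      (hf.continuous_mul_ofReal (by fun_prop))
  · have hexp : IntegrableOn (fun t : ℝ => C * Real.exp ((l.re - 1) * t)) (Set.Ioi T) :=
      (integrableOn_exp_mul_Ioi (by linarith) T).const_mul C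
    refine hexp.mono' ?_ ?_
    · have : Measurable fun t : ℝ => Complex.exp (l * t) * (f t : ℂ) := by fun_prop
      exact this.aestronglyMeasurable
    · filter_upwards [ae_restrict_mem measurableSet_Ioi] with t ht
      rw [norm_mul, Complex.norm_exp, Complex.norm_real, Real.norm_eq_abs]
      have h1 : (l * t).re = l.re * t := by simp
      rw [h1]
      calc Real.exp (l.re * t) * |f t| ≤ Real.exp (l.re * t) * (C * Real.exp (-t)) := by
            gcongr; exact hb t ht
        _ = C * Real.exp ((l.re - 1) * t) := by
            rw [mul_left_comm, ← Real.exp_add]; ring_nf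

lemma measurable_coshLogDiff (c : ℝ) : Measurable (coshLogDiff c) := by
  unfold coshLogDiff; fun_prop

lemma measurable_coshSignDiff (c : ℝ) : Measurable (coshSignDiff c) :=
  (measurable_real_sign.comp (by fun_prop)).sub (measurable_real_sign.comp (by fun_prop))

lemma lt_exp_of_log_lt {c t : ℝ} (ht : Real.log (4 * |c| + 1) < t) : 4 * |c| + 1 < Real.exp t :=
  (Real.log_lt_iff_lt_exp (by positivity)).1 ht

lemma integrableOn_exp_mul_coshLogDiff {l : ℂ} (hl : l.re < 1) (c : ℝ) :
    IntegrableOn (fun t : ℝ => Complex.exp (l * t) * (coshLogDiff c t : ℂ)) (Set.Ioi 0) :=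
  -- Beyond this `T` the decay estimate applies; the `+ 1` keeps `T ≥ 0`, also for `c = 0`.
  integrableOn_exp_mul_ofReal hl (C := 8 * |c|) (T := Real.log (4 * |c| + 1))
    (Real.log_nonneg (by linarith [abs_nonneg c])) (intervalIntegrable_coshLogDiff c _ _)
    (measurable_coshLogDiff c)
    fun t ht => abs_coshLogDiff_le (by linarith [lt_exp_of_log_lt ht])

lemma integrableOn_exp_mul_coshSignDiff {l : ℂ} (hl : l.re < 1) (c : ℝ) :
    IntegrableOn (fun t : ℝ => Complex.exp (l * t) * (coshSignDiff c t : ℂ)) (Set.Ioi 0) :=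
  integrableOn_exp_mul_ofReal hl (C := 0) (T := Real.log (4 * |c| + 1))
    (Real.log_nonneg (by linarith [abs_nonneg c])) (intervalIntegrable_coshSignDiff c _ _)
    (measurable_coshSignDiff c)
    fun t ht => by
      rw [coshSignDiff_eq_zero, abs_zero, zero_mul]
      linarith [lt_exp_of_log_lt ht, exp_le_two_mul_cosh t, abs_nonneg c]

/-! ### Contributions of the four edges and the limit `T → ∞`. -/

lemma integral_sinh_edge_sub (l c w₀ v : ℂ) (a b : ℝ) :
    (∫ t in a..b, Complex.exp (l * (w₀ + t * v)) * Complex.log (Complex.sinh (w₀ + t * v) + c))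
      - (∫ t in a..b, Complex.exp (l * (w₀ + t * v)) *
          Complex.log (Complex.sinh (w₀ + t * v) + -c))
    = ∫ t in a..b, Complex.exp (l * (w₀ + t * v)) *
        (Complex.log (Complex.sinh (w₀ + t * v) + c)
          - Complex.log (Complex.sinh (w₀ + t * v) + -c)) := by
  rw [← intervalIntegral.integral_sub (intervalIntegrable_exp_mul_log_sinh l c w₀ v a b)
    (intervalIntegrable_exp_mul_log_sinh l (-c) w₀ v a b)]
  simp only [mul_sub]

/-- Linearity, for an integrand split into two real parts with continuous complex weights. -/
lemma integral_mul_add_ofReal {f g : ℝ → ℝ} {e : ℝ → ℂ} {a b : ℝ} (he : Continuous e)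
    (hf : IntervalIntegrable f volume a b) (hg : IntervalIntegrable g volume a b) (p q : ℂ) :
    ∫ t in a..b, (p * (e t * (f t : ℂ)) + q * (e t * (g t : ℂ)))
      = p * (∫ t in a..b, e t * (f t : ℂ)) + q * (∫ t in a..b, e t * (g t : ℂ)) := by
  rw [intervalIntegral.integral_add ((hf.continuous_mul_ofReal he).const_mul p)
    ((hg.continuous_mul_ofReal he).const_mul q), intervalIntegral.integral_const_mul,
    intervalIntegral.integral_const_mul]

lemma integral_bottom_edge (l : ℂ) (c T : ℝ) :
    ∫ t in (0:ℝ)..T, Complex.exp (l * (((-(Real.pi / 2) : ℝ) : ℂ) * Complex.I + t * 1)) *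
        (Complex.log (Complex.sinh (((-(Real.pi / 2) : ℝ) : ℂ) * Complex.I + t * 1)
            + c * Complex.I)
          - Complex.log (Complex.sinh (((-(Real.pi / 2) : ℝ) : ℂ) * Complex.I + t * 1)
            + -(c * Complex.I)))
    = -Complex.exp (-(l * (Real.pi / 2) * Complex.I))
        * (∫ t in (0:ℝ)..T, Complex.exp (l * t) * (coshLogDiff c t : ℂ))
      + Real.pi / 2 * Complex.I * Complex.exp (-(l * (Real.pi / 2) * Complex.I))
        * (∫ t in (0:ℝ)..T, Complex.exp (l * t) * (coshSignDiff c t : ℂ)) := by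
  rw [← integral_mul_add_ofReal (e := fun t : ℝ => Complex.exp (l * t)) (by fun_prop)
    (intervalIntegrable_coshLogDiff c 0 T) (intervalIntegrable_coshSignDiff c 0 T)]
  refine intervalIntegral.integral_congr fun t _ => ?_
  have e1 : Complex.I * ((-Real.cosh t : ℝ) : ℂ) + c * Complex.I
      = Complex.I * ((-(Real.cosh t - c) : ℝ) : ℂ) := by push_cast; ring
  have e2 : Complex.I * ((-Real.cosh t : ℝ) : ℂ) + -(c * Complex.I)
      = Complex.I * ((-(Real.cosh t + c) : ℝ) : ℂ) := by push_cast; ring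
  have e3 : Complex.exp (l * (((-(Real.pi / 2) : ℝ) : ℂ) * Complex.I + t * 1))
      = Complex.exp (-(l * (Real.pi / 2) * Complex.I)) * Complex.exp (l * t) := by
    rw [← Complex.exp_add]; push_cast; ring_nf
  simp only [sinh_neg_pi_div_two_add, e1, e2, e3, clog_I_mul, abs_neg, coshLogDiff, coshSignDiff,
    Real.sign_neg]
  push_cast
  ring

lemma integral_top_edge (l : ℂ) (c T : ℝ) :
    ∫ t in (0:ℝ)..T, Complex.exp (l * (((Real.pi / 2 : ℝ) : ℂ) * Complex.I + t * 1)) *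
        (Complex.log (Complex.sinh (((Real.pi / 2 : ℝ) : ℂ) * Complex.I + t * 1)
            + c * Complex.I)
          - Complex.log (Complex.sinh (((Real.pi / 2 : ℝ) : ℂ) * Complex.I + t * 1)
            + -(c * Complex.I)))
    = Complex.exp (l * (Real.pi / 2) * Complex.I)
        * (∫ t in (0:ℝ)..T, Complex.exp (l * t) * (coshLogDiff c t : ℂ))
      + Real.pi / 2 * Complex.I * Complex.exp (l * (Real.pi / 2) * Complex.I)
        * (∫ t in (0:ℝ)..T, Complex.exp (l * t) * (coshSignDiff c t : ℂ)) := by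
  rw [← integral_mul_add_ofReal (e := fun t : ℝ => Complex.exp (l * t)) (by fun_prop)
    (intervalIntegrable_coshLogDiff c 0 T) (intervalIntegrable_coshSignDiff c 0 T)]
  refine intervalIntegral.integral_congr fun t _ => ?_
  have e1 : Complex.I * ((Real.cosh t : ℝ) : ℂ) + c * Complex.I
      = Complex.I * ((Real.cosh t + c : ℝ) : ℂ) := by push_cast; ring
  have e2 : Complex.I * ((Real.cosh t : ℝ) : ℂ) + -(c * Complex.I)
      = Complex.I * ((Real.cosh t - c : ℝ) : ℂ) := by push_cast; ring
  have e3 : Complex.exp (l * (((Real.pi / 2 : ℝ) : ℂ) * Complex.I + t * 1))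
      = Complex.exp (l * (Real.pi / 2) * Complex.I) * Complex.exp (l * t) := by
    rw [← Complex.exp_add]; push_cast; ring_nf
  simp only [sinh_pi_div_two_add, e1, e2, e3, clog_I_mul, coshLogDiff, coshSignDiff]
  push_cast
  ring

/-- The reflection `y ↦ -y` exchanges `log |sin y - c|` and `log |sin y + c|`, so the two
exponentials combine into a sine against a single logarithm. -/
lemma integral_left_edge (l : ℂ) (c : ℝ) :
    Complex.I * (∫ y in (-(Real.pi / 2))..(Real.pi / 2),
        Complex.exp (l * (((0 : ℝ) : ℂ) + y * Complex.I)) *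
        (Complex.log (Complex.sinh (((0 : ℝ) : ℂ) + y * Complex.I) + c * Complex.I)
          - Complex.log (Complex.sinh (((0 : ℝ) : ℂ) + y * Complex.I) + -(c * Complex.I))))
    = -2 * (∫ y in (-(Real.pi / 2))..(Real.pi / 2),
        Complex.sin (l * y) * (Real.log |Real.sin y + c| : ℝ))
      - Real.pi / 2 * (∫ y in (-(Real.pi / 2))..(Real.pi / 2), Complex.exp (l * y * Complex.I) *
        ((Real.sign (Real.sin y + c) - Real.sign (Real.sin y - c) : ℝ) : ℂ)) := by
  have hL : ∀ s : ℝ, IntervalIntegrable (fun y => Real.log |Real.sin y + s|) volume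
    (-(Real.pi / 2)) (Real.pi / 2) := fun s => intervalIntegrable_log_abs_sin s _ _
  have hS := (intervalIntegrable_sign_comp (f := fun y => Real.sin y + c) (by fun_prop)
    (-(Real.pi / 2)) (Real.pi / 2)).sub
    (intervalIntegrable_sign_comp (f := fun y => Real.sin y - c) (by fun_prop)
    (-(Real.pi / 2)) (Real.pi / 2))
  have h1 : ∫ y in (-(Real.pi / 2))..(Real.pi / 2),
        Complex.exp (l * (((0 : ℝ) : ℂ) + y * Complex.I)) *
        (Complex.log (Complex.sinh (((0 : ℝ) : ℂ) + y * Complex.I) + c * Complex.I)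
          - Complex.log (Complex.sinh (((0 : ℝ) : ℂ) + y * Complex.I) + -(c * Complex.I)))
      = 1 * (∫ y in (-(Real.pi / 2))..(Real.pi / 2), Complex.exp (l * y * Complex.I) *
          ((Real.log |Real.sin y + c| - Real.log |Real.sin y + -c| : ℝ) : ℂ))
        + Real.pi / 2 * Complex.I * (∫ y in (-(Real.pi / 2))..(Real.pi / 2),
          Complex.exp (l * y * Complex.I) *
          ((Real.sign (Real.sin y + c) - Real.sign (Real.sin y - c) : ℝ) : ℂ)) := by
    rw [← integral_mul_add_ofReal (e := fun y : ℝ => Complex.exp (l * y * Complex.I))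
      (by fun_prop) ((hL c).sub (hL (-c))) hS]
    refine intervalIntegral.integral_congr fun y _ => ?_
    have e1 : Complex.I * ((Real.sin y : ℝ) : ℂ) + c * Complex.I
        = Complex.I * ((Real.sin y + c : ℝ) : ℂ) := by push_cast; ring
    have e2 : Complex.I * ((Real.sin y : ℝ) : ℂ) + -(c * Complex.I)
        = Complex.I * ((Real.sin y - c : ℝ) : ℂ) := by push_cast; ring
    have e3 : l * (((0 : ℝ) : ℂ) + y * Complex.I) = l * y * Complex.I := by push_cast; ring
    simp only [sinh_zero_add_mul_I, e1, e2, e3, clog_I_mul, ← sub_eq_add_neg]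
    push_cast
    ring
  have h2 : ∫ y in (-(Real.pi / 2))..(Real.pi / 2), Complex.exp (l * y * Complex.I) *
          ((Real.log |Real.sin y + -c| : ℝ) : ℂ)
      = ∫ y in (-(Real.pi / 2))..(Real.pi / 2), Complex.exp (-(l * y * Complex.I)) *
          ((Real.log |Real.sin y + c| : ℝ) : ℂ) := by
    have := intervalIntegral.integral_comp_neg (a := -(Real.pi / 2)) (b := Real.pi / 2)
      (fun y : ℝ => Complex.exp (l * y * Complex.I) * ((Real.log |Real.sin y + -c| : ℝ) : ℂ))
    rw [neg_neg] at this
    rw [← this]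
    refine intervalIntegral.integral_congr fun y _ => ?_
    have : |Real.sin (-y) + -c| = |Real.sin y + c| := by
      rw [Real.sin_neg, ← neg_add, abs_neg]
    simp only [this]
    push_cast
    ring_nf
  have h3 : ∫ y in (-(Real.pi / 2))..(Real.pi / 2), Complex.exp (l * y * Complex.I) *
          ((Real.log |Real.sin y + c| - Real.log |Real.sin y + -c| : ℝ) : ℂ)
      = 2 * Complex.I * ∫ y in (-(Real.pi / 2))..(Real.pi / 2),
        Complex.sin (l * y) * (Real.log |Real.sin y + c| : ℝ) := by
    simp only [Complex.ofReal_sub, mul_sub]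
    rw [intervalIntegral.integral_sub ((hL c).continuous_mul_ofReal (by fun_prop))
      ((hL (-c)).continuous_mul_ofReal (by fun_prop)), h2,
      ← intervalIntegral.integral_sub ((hL c).continuous_mul_ofReal (by fun_prop))
      ((hL c).continuous_mul_ofReal (by fun_prop)), ← intervalIntegral.integral_const_mul]
    refine intervalIntegral.integral_congr fun y _ => ?_
    simp only [Complex.sin, neg_mul]
    linear_combination (Complex.exp (-(l * y * Complex.I)) - Complex.exp (l * y * Complex.I)) *
      (Real.log |Real.sin y + c| : ℂ) * -Complex.I_sq
  rw [h1, h3]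
  linear_combination (2 * (∫ y in (-(Real.pi / 2))..(Real.pi / 2),
        Complex.sin (l * y) * (Real.log |Real.sin y + c| : ℝ)) +
      Real.pi / 2 * (∫ y in (-(Real.pi / 2))..(Real.pi / 2), Complex.exp (l * y * Complex.I) *
        ((Real.sign (Real.sin y + c) - Real.sign (Real.sin y - c) : ℝ) : ℂ))) * Complex.I_sq

/-- Cauchy's theorem for `c` minus that for `-c`. The phases `exp (± i l π/2)` of the horizontal
edges add up to a cosine on the modulus part and a sine on the sign part. -/
lemma truncated_strip_identity (l : ℂ) (c : ℝ) {T : ℝ} (hT : 0 ≤ T) :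
    -2 * Complex.cos (l * (Real.pi / 2))
        * (∫ t in (0:ℝ)..T, Complex.exp (l * t) * (coshLogDiff c t : ℂ))
      + Real.pi * Complex.sin (l * (Real.pi / 2))
        * (∫ t in (0:ℝ)..T, Complex.exp (l * t) * (coshSignDiff c t : ℂ))
      + 2 * (∫ y in (-(Real.pi / 2))..(Real.pi / 2),
        Complex.sin (l * y) * (Real.log |Real.sin y + c| : ℝ))
      + Real.pi / 2 * (∫ y in (-(Real.pi / 2))..(Real.pi / 2), Complex.exp (l * y * Complex.I) *
        ((Real.sign (Real.sin y + c) - Real.sign (Real.sin y - c) : ℝ) : ℂ))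
      + Complex.I * (∫ y in (-(Real.pi / 2))..(Real.pi / 2),
        Complex.exp (l * ((T : ℂ) + y * Complex.I)) *
        (Complex.log (Complex.sinh ((T : ℂ) + y * Complex.I) + c * Complex.I)
          - Complex.log (Complex.sinh ((T : ℂ) + y * Complex.I) + -(c * Complex.I)))) = 0 := by
  have hp := integral_boundary_rect_exp_mul_log_sinh l c hT
  have hm := integral_boundary_rect_exp_mul_log_sinh l (-c) hT
  simp only [Complex.ofReal_neg c, neg_mul (c : ℂ)] at hm
  have hb := integral_bottom_edge l c T
  have ht := integral_top_edge l c T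
  have hl := integral_left_edge l c
  rw [← integral_sinh_edge_sub] at hb ht hl
  rw [← integral_sinh_edge_sub, Complex.cos, Complex.sin, neg_mul (l * (Real.pi / 2 : ℂ))]
  linear_combination hp - hm - hb + ht + hl

open Filter Topology in
lemma tendsto_integral_right_edge {l : ℂ} (hl : l.re < 1) (c : ℝ) :
    Tendsto (fun T : ℝ => ∫ y in (-(Real.pi / 2))..(Real.pi / 2),
        Complex.exp (l * ((T : ℂ) + y * Complex.I)) *
        (Complex.log (Complex.sinh ((T : ℂ) + y * Complex.I) + c * Complex.I)
          - Complex.log (Complex.sinh ((T : ℂ) + y * Complex.I) + -(c * Complex.I))))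
      atTop (𝓝 0) := by
  have hpi := Real.pi_pos
  have hle : -(Real.pi / 2) ≤ Real.pi / 2 := by linarith
  have hlim : Tendsto (fun T : ℝ => (Real.exp (|l.im| * (Real.pi / 2)) * (16 * |c|)
      * |Real.pi / 2 - -(Real.pi / 2)|) * Real.exp ((l.re - 1) * T)) atTop (𝓝 0) := by
    rw [← mul_zero (Real.exp (|l.im| * (Real.pi / 2)) * (16 * |c|)
      * |Real.pi / 2 - -(Real.pi / 2)|)]
    exact (Real.tendsto_exp_atBot.comp
      (tendsto_id.const_mul_atTop_of_neg (by linarith))).const_mul _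
  refine squeeze_zero_norm' ?_ hlim
  -- `T ≥ 1` gives `‖sinh‖ ≥ exp T / 4`, and then `8 |c| ≤ exp T` gives the hypothesis `2 |c| ≤
  -- ‖sinh‖` of `norm_clog_add_sub_le`.
  filter_upwards [eventually_ge_atTop (1 : ℝ),
    Real.tendsto_exp_atTop.eventually_ge_atTop (8 * |c|)] with T hT1 hTc
  have hbound : ∀ y ∈ Set.uIoc (-(Real.pi / 2)) (Real.pi / 2),
      ‖Complex.exp (l * ((T : ℂ) + y * Complex.I)) *
        (Complex.log (Complex.sinh ((T : ℂ) + y * Complex.I) + c * Complex.I)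
          - Complex.log (Complex.sinh ((T : ℂ) + y * Complex.I) + -(c * Complex.I)))‖
      ≤ Real.exp (|l.im| * (Real.pi / 2)) * (16 * |c|) * Real.exp ((l.re - 1) * T) := by
    intro y hy
    rw [Set.uIoc_of_le hle] at hy
    have hsinh : Real.exp T / 4 ≤ ‖Complex.sinh ((T : ℂ) + y * Complex.I)‖ := by
      have h1 : Complex.sinh ((T : ℂ) + y * Complex.I) = (Complex.exp ((T : ℂ) + y * Complex.I)
        - Complex.exp (-((T : ℂ) + y * Complex.I))) / 2 := rfl
      have h2 := norm_sub_norm_le (Complex.exp ((T : ℂ) + y * Complex.I))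
        (Complex.exp (-((T : ℂ) + y * Complex.I)))
      rw [Complex.norm_exp, Complex.norm_exp] at h2
      simp only [Complex.add_re, Complex.neg_re, Complex.ofReal_re, Complex.re_ofReal_mul,
        Complex.I_re, mul_zero, add_zero] at h2
      rw [h1, norm_div, Complex.norm_two]
      have h3 : Real.exp (-T) ≤ 1 := Real.exp_le_one_iff.2 (by linarith)
      have h4 := Real.add_one_le_exp T
      linarith
    have key := norm_clog_add_sub_le (z := Complex.sinh ((T : ℂ) + y * Complex.I)) (c := c)
      (sinh_re_nonneg (by simp; linarith) (by simp; linarith [hy.1]) (by simp; linarith [hy.2]))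
      (by linarith)
    rw [Complex.ofReal_neg, neg_mul] at key
    rw [norm_mul, Complex.norm_exp]
    have hpos := Real.exp_pos T
    have key2 : 4 * |c| / ‖Complex.sinh ((T : ℂ) + y * Complex.I)‖
        ≤ 16 * |c| * Real.exp (-T) := by
      rw [Real.exp_neg]
      calc 4 * |c| / ‖Complex.sinh ((T : ℂ) + y * Complex.I)‖ ≤ 4 * |c| / (Real.exp T / 4) := by
            gcongr
        _ = 16 * |c| * (Real.exp T)⁻¹ := by field_simp; ring
    have hre : (l * ((T : ℂ) + y * Complex.I)).re ≤ l.re * T + |l.im| * (Real.pi / 2) := by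
      have : (l * ((T : ℂ) + y * Complex.I)).re = l.re * T - l.im * y := by simp
      rw [this]
      have h5 : |y| ≤ Real.pi / 2 := abs_le.2 ⟨hy.1.le, hy.2⟩
      have h6 : -(l.im * y) ≤ |l.im| * |y| := by
        rw [← abs_mul]; exact neg_le_abs _
      nlinarith [abs_nonneg l.im]
    calc _ ≤ Real.exp (l.re * T + |l.im| * (Real.pi / 2)) * (16 * |c| * Real.exp (-T)) := by
          gcongr
          exact key.trans key2
      _ = Real.exp (|l.im| * (Real.pi / 2)) * (16 * |c|)
          * (Real.exp (l.re * T) * Real.exp (-T)) := by rw [Real.exp_add]; ring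
      _ = _ := by rw [← Real.exp_add]; ring_nf
  refine (intervalIntegral.norm_integral_le_of_norm_le_const hbound).trans (le_of_eq ?_)
  ring

open Filter Topology in
/-- The identity obtained from the half strip `0 ≤ Re w`, `|Im w| ≤ π / 2`. -/
lemma strip_identity {l : ℂ} (hl : l.re < 1) (c : ℝ) :
    -2 * Complex.cos (l * (Real.pi / 2))
        * (∫ t in Set.Ioi (0:ℝ), Complex.exp (l * t) * (coshLogDiff c t : ℂ))
      + Real.pi * Complex.sin (l * (Real.pi / 2))
        * (∫ t in Set.Ioi (0:ℝ), Complex.exp (l * t) * (coshSignDiff c t : ℂ))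
      + 2 * (∫ y in (-(Real.pi / 2))..(Real.pi / 2),
        Complex.sin (l * y) * (Real.log |Real.sin y + c| : ℝ))
      + Real.pi / 2 * (∫ y in (-(Real.pi / 2))..(Real.pi / 2), Complex.exp (l * y * Complex.I) *
        ((Real.sign (Real.sin y + c) - Real.sign (Real.sin y - c) : ℝ) : ℂ)) = 0 := by
  have h1 := intervalIntegral_tendsto_integral_Ioi 0 (integrableOn_exp_mul_coshLogDiff hl c)
    tendsto_id
  have h2 := intervalIntegral_tendsto_integral_Ioi 0 (integrableOn_exp_mul_coshSignDiff hl c)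
    tendsto_id
  have h3 := tendsto_integral_right_edge hl c
  have hlim := ((((h1.const_mul (-2 * Complex.cos (l * (Real.pi / 2)))).add
    (h2.const_mul (Real.pi * Complex.sin (l * (Real.pi / 2))))).add_const
    (2 * (∫ y in (-(Real.pi / 2))..(Real.pi / 2),
        Complex.sin (l * y) * (Real.log |Real.sin y + c| : ℝ)))).add_const
    (Real.pi / 2 * (∫ y in (-(Real.pi / 2))..(Real.pi / 2), Complex.exp (l * y * Complex.I) *
        ((Real.sign (Real.sin y + c) - Real.sign (Real.sin y - c) : ℝ) : ℂ)))).add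
    (h3.const_mul Complex.I)
  rw [mul_zero, add_zero] at hlim
  refine tendsto_nhds_unique (hlim.congr' ?_) tendsto_const_nhds
  filter_upwards [eventually_ge_atTop (0 : ℝ)] with T hT
  exact truncated_strip_identity l c hT

/-! ### Evaluation of the sign terms for `c = sin y` and `c = cosh s`. -/

lemma mul_integral_exp_mul (l : ℂ) (a b : ℝ) :
    l * ∫ t in a..b, Complex.exp (l * t) = Complex.exp (l * b) - Complex.exp (l * a) := by
  rcases eq_or_ne l 0 with rfl | hl
  · simp
  · rw [integral_exp_mul_complex hl]
    field_simp

lemma mul_integral_exp_mul_I (l : ℂ) (y : ℝ) :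
    l * ∫ t in (-y)..y, Complex.exp (l * t * Complex.I) = 2 * Complex.sin (l * y) := by
  have h := mul_integral_exp_mul (l * Complex.I) (-y) y
  have e : ∀ t : ℝ, l * t * Complex.I = l * Complex.I * t := fun t => by ring
  simp only [e]
  rw [Complex.sin]
  have e1 : l * Complex.I * ((-y : ℝ) : ℂ) = -(l * y) * Complex.I := by push_cast; ring
  have e2 : l * Complex.I * (y : ℂ) = (l * y) * Complex.I := by ring
  rw [e1, e2] at h
  linear_combination (-Complex.I) * h
    + l * (∫ t in (-y)..y, Complex.exp (l * Complex.I * t)) * Complex.I_sq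

lemma integral_mul_sign_sin_sub {g : ℝ → ℂ} (hg : Continuous g) {y : ℝ}
    (h1 : -(Real.pi / 2) ≤ y) (h2 : y ≤ Real.pi / 2) :
    ∫ x in (-(Real.pi / 2))..(Real.pi / 2), g x * (Real.sign (Real.sin x - Real.sin y) : ℂ)
      = (∫ x in y..(Real.pi / 2), g x) - ∫ x in (-(Real.pi / 2))..y, g x := by
  have hi : ∀ a b : ℝ, IntervalIntegrable
      (fun x => g x * (Real.sign (Real.sin x - Real.sin y) : ℂ)) volume a b := fun a b =>
    (intervalIntegrable_sign_comp (f := fun x => Real.sin x - Real.sin y)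
      (by fun_prop) a b).continuous_mul_ofReal hg
  rw [← intervalIntegral.integral_add_adjacent_intervals (hi _ y) (hi y _)]
  have hne : ∀ᵐ x : ℝ, x ≠ y := by simp [ae_iff, measure_singleton]
  have e1 : ∫ x in (-(Real.pi / 2))..y, g x * (Real.sign (Real.sin x - Real.sin y) : ℂ)
      = ∫ x in (-(Real.pi / 2))..y, -g x := by
    refine intervalIntegral.integral_congr_ae ?_
    filter_upwards [hne] with x hx hmem
    rw [Set.uIoc_of_le h1] at hmem
    have := Real.strictMonoOn_sin ⟨hmem.1.le, hmem.2.trans h2⟩ ⟨h1, h2⟩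
      (lt_of_le_of_ne hmem.2 hx)
    rw [Real.sign_of_neg (by linarith)]
    simp
  have e2 : ∫ x in y..(Real.pi / 2), g x * (Real.sign (Real.sin x - Real.sin y) : ℂ)
      = ∫ x in y..(Real.pi / 2), g x := by
    refine intervalIntegral.integral_congr_ae (ae_of_all _ fun x hmem => ?_)
    rw [Set.uIoc_of_le h2] at hmem
    have := Real.strictMonoOn_sin ⟨h1, h2⟩ ⟨h1.trans hmem.1.le, hmem.2⟩ hmem.1
    rw [Real.sign_of_pos (by linarith)]
    simp
  rw [e1, e2, intervalIntegral.integral_neg]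
  ring

/-- Monotonicity of `sin` puts the sign changes at `±y`. Negative `y` is allowed: the oriented
integral supplies the sign. -/
lemma integral_mul_sign_sin_add_sub {g : ℝ → ℂ} (hg : Continuous g) {y : ℝ}
    (h1 : -(Real.pi / 2) ≤ y) (h2 : y ≤ Real.pi / 2) :
    ∫ x in (-(Real.pi / 2))..(Real.pi / 2), g x *
        ((Real.sign (Real.sin x + Real.sin y) - Real.sign (Real.sin x - Real.sin y) : ℝ) : ℂ)
      = 2 * ∫ x in (-y)..y, g x := by
  have hs : ∀ s : ℝ, IntervalIntegrable
      (fun x => g x * (Real.sign (Real.sin x - Real.sin s) : ℂ)) volume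
      (-(Real.pi / 2)) (Real.pi / 2) := fun s =>
    (intervalIntegrable_sign_comp (f := fun x => Real.sin x - Real.sin s)
      (by fun_prop) _ _).continuous_mul_ofReal hg
  have e : ∀ x : ℝ, Real.sin x + Real.sin y = Real.sin x - Real.sin (-y) := fun x => by
    rw [Real.sin_neg, sub_neg_eq_add]
  simp only [e, Complex.ofReal_sub, mul_sub]
  rw [intervalIntegral.integral_sub (hs _) (hs _), integral_mul_sign_sin_sub hg h1 h2,
    integral_mul_sign_sin_sub hg (y := -y) (by linarith) (by linarith)]
  have hi : ∀ a b : ℝ, IntervalIntegrable g volume a b := fun a b => hg.intervalIntegrable a b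
  rw [← intervalIntegral.integral_add_adjacent_intervals (hi (-y) y) (hi y (Real.pi / 2)),
    ← intervalIntegral.integral_add_adjacent_intervals (hi (-(Real.pi / 2)) (-y)) (hi (-y) y)]
  ring

/-- The strip identity for `c = sin y`. -/
lemma strip_identity_sin {l : ℂ} (hl : l.re < 1) {y : ℝ}
    (h1 : -(Real.pi / 2) ≤ y) (h2 : y ≤ Real.pi / 2) :
    l * Complex.cos (l * (Real.pi / 2))
        * (∫ t in Set.Ioi (0:ℝ), Complex.exp (l * t) * (coshLogDiff (Real.sin y) t : ℂ))
      = l * (∫ x in (-(Real.pi / 2))..(Real.pi / 2),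
          Complex.sin (l * x) * (Real.log |Real.sin x + Real.sin y| : ℝ))
        + Real.pi * Complex.sin (l * y) := by
  have h := strip_identity hl (Real.sin y)
  -- As `|sin y| ≤ 1 < cosh t`, the horizontal edges carry no sign jump; only the left edge does.
  have hz : ∫ t in Set.Ioi (0:ℝ), Complex.exp (l * t) * (coshSignDiff (Real.sin y) t : ℂ) = 0 := by
    refine setIntegral_eq_zero_of_forall_eq_zero fun t ht => ?_
    rw [coshSignDiff_eq_zero]
    · simp
    · exact (Real.abs_sin_le_one y).trans_lt (Real.one_lt_cosh.2 (ne_of_gt ht))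
  rw [hz, integral_mul_sign_sin_add_sub (g := fun x : ℝ => Complex.exp (l * x * Complex.I))
    (by fun_prop) h1 h2] at h
  linear_combination (-l / 2) * h + (Real.pi / 2) * mul_integral_exp_mul_I l y

lemma integral_exp_mul_coshSignDiff_cosh (l : ℂ) {s : ℝ} (hs : 0 < s) :
    ∫ t in Set.Ioi (0:ℝ), Complex.exp (l * t) * (coshSignDiff (Real.cosh s) t : ℂ)
      = 2 * ∫ t in (0:ℝ)..s, Complex.exp (l * t) := by
  have hne : ∀ᵐ x : ℝ, x ≠ s := by simp [ae_iff, measure_singleton]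
  have e : ∫ t in Set.Ioi (0:ℝ), Complex.exp (l * t) * (coshSignDiff (Real.cosh s) t : ℂ)
      = ∫ t in Set.Ioi (0:ℝ), (Set.Ioc 0 s).indicator (fun t : ℝ => 2 * Complex.exp (l * t)) t := by
    refine setIntegral_congr_ae measurableSet_Ioi ?_
    filter_upwards [hne] with t ht hmem
    have h0 : 0 < t := hmem
    have hc1 := Real.cosh_pos t
    have hc2 := Real.cosh_pos s
    rcases lt_or_gt_of_ne ht with h | h
    · have hc : Real.cosh t < Real.cosh s := by
        rw [Real.cosh_lt_cosh, abs_of_pos h0, abs_of_pos hs]; exact h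
      rw [Set.indicator_of_mem (Set.mem_Ioc.2 ⟨h0, h.le⟩), coshSignDiff, Real.sign_of_pos (by linarith),
        Real.sign_of_neg (by linarith)]
      push_cast; ring
    · have hc : Real.cosh s < Real.cosh t := by
        rw [Real.cosh_lt_cosh, abs_of_pos h0, abs_of_pos hs]; exact h
      rw [Set.indicator_of_notMem (fun h' => absurd h'.2 (not_le.2 h)),
        coshSignDiff_eq_zero (by rwa [abs_of_pos hc2])]
      simp
  rw [e, setIntegral_indicator measurableSet_Ioc, Set.inter_eq_right.2 Set.Ioc_subset_Ioi_self,
    ← intervalIntegral.integral_of_le hs.le, intervalIntegral.integral_const_mul]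

/-- The strip identity for `c = cosh s`. -/
lemma strip_identity_cosh {l : ℂ} (hl : l.re < 1) {s : ℝ} (hs : 0 < s) :
    l * Complex.cos (l * (Real.pi / 2))
        * (∫ t in Set.Ioi (0:ℝ), Complex.exp (l * t) * (coshLogDiff (Real.cosh s) t : ℂ))
      = l * (∫ x in (-(Real.pi / 2))..(Real.pi / 2),
          Complex.sin (l * x) * (Real.log |Real.sin x + Real.cosh s| : ℝ))
        + Real.pi * Complex.sin (l * (Real.pi / 2)) * Complex.exp (l * s) := by
  have h := strip_identity hl (Real.cosh s)
  have hc : 1 < Real.cosh s := Real.one_lt_cosh.2 hs.ne'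
  have hsgn : ∀ x : ℝ, Real.sign (Real.sin x + Real.cosh s) - Real.sign (Real.sin x - Real.cosh s)
      = 2 := fun x => by
    rw [Real.sign_of_pos (by linarith [Real.neg_one_le_sin x]),
      Real.sign_of_neg (by linarith [Real.sin_le_one x])]
    norm_num
  simp only [hsgn] at h
  rw [integral_exp_mul_coshSignDiff_cosh l hs, intervalIntegral.integral_mul_const] at h
  have h3 := mul_integral_exp_mul l 0 s
  have h4 := mul_integral_exp_mul_I l (Real.pi / 2)
  rw [Complex.ofReal_zero, mul_zero, Complex.exp_zero] at h3
  push_cast at h h3 h4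
  -- The endpoint value `exp 0 = 1` in `h3` produces a term `π sin (l π/2)` that cancels the
  -- left-edge sign term from `h4`.
  linear_combination (-l / 2) * h + Real.pi * Complex.sin (l * (Real.pi / 2)) * h3
    + (Real.pi / 2) * h4

/-! ### Change of variables and conclusion. -/

lemma intervalIntegrable_arc (α C : ℝ) (k : ℂ) :
    IntervalIntegrable (fun θ : ℝ => Complex.sin (k * θ) *
      (Real.log |C + Real.sin (Real.pi * θ / (2 * α))| : ℝ)) volume (-α) α := by
  have h : AnalyticOnNhd ℝ (fun θ => C + Real.sin (Real.pi * θ / (2 * α))) Set.univ :=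
    fun t _ => by
      simp only [div_eq_mul_inv]
      fun_prop
  have h2 : IntervalIntegrable (fun θ => Real.log |C + Real.sin (Real.pi * θ / (2 * α))|)
      volume (-α) α :=
    MeromorphicOn.intervalIntegrable_log_norm (f := fun θ => C + Real.sin (Real.pi * θ / (2 * α)))
      fun t _ => (h t trivial).meromorphicAt
  exact h2.continuous_mul_ofReal (by fun_prop)

lemma integral_arc {α : ℝ} (hα : 0 < α) (C : ℝ) (k : ℂ) :
    ∫ θ in (-α)..α, Complex.sin (k * θ) *
      (Real.log |C + Real.sin (Real.pi * θ / (2 * α))| : ℝ)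
    = ((2 * α / Real.pi : ℝ) : ℂ) * ∫ x in (-(Real.pi / 2))..(Real.pi / 2),
      Complex.sin (((2 * α / Real.pi : ℝ) : ℂ) * k * x) * (Real.log |Real.sin x + C| : ℝ) := by
  have hpi := Real.pi_pos
  have hb : 2 * α / Real.pi ≠ 0 := by positivity
  have h := intervalIntegral.integral_comp_mul_left (a := -(Real.pi / 2)) (b := Real.pi / 2)
    (fun θ : ℝ => Complex.sin (k * θ) *
      (Real.log |C + Real.sin (Real.pi * θ / (2 * α))| : ℝ)) hb
  have e1 : 2 * α / Real.pi * (Real.pi / 2) = α := by field_simp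
  have e2 : 2 * α / Real.pi * -(Real.pi / 2) = -α := by rw [mul_neg, e1]
  have e3 : ∀ x : ℝ, Real.pi * (2 * α / Real.pi * x) / (2 * α) = x := fun x => by field_simp
  have e4 : ∀ x : ℝ, k * ((2 * α / Real.pi * x : ℝ) : ℂ)
      = ((2 * α / Real.pi : ℝ) : ℂ) * k * x := fun x => by
    rw [Complex.ofReal_mul]; ring
  rw [e1, e2] at h
  simp only [e3, e4, add_comm C] at h
  simp only [add_comm C]
  rw [h, Complex.real_smul, ← mul_assoc, ← Complex.ofReal_mul, mul_inv_cancel₀ hb,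
    Complex.ofReal_one, one_mul]

/-- Substitution `r = a exp (b t)` in a Mellin type integral over `(a, ∞)`. -/
lemma mellin_tail_substitution {a b : ℝ} (ha : 0 < a) (hb : 0 < b) (k : ℂ) {h H : ℝ → ℝ}
    (hH : ∀ᵐ t : ℝ, 0 < t → h (a * Real.exp (b * t)) = H t)
    (hint : IntegrableOn (fun t : ℝ => Complex.exp (b * k * t) * (H t : ℂ)) (Set.Ioi 0)) :
    IntegrableOn (fun r : ℝ => ((r / a : ℝ) : ℂ) ^ k * (h r : ℂ) / (r : ℂ)) (Set.Ioi a) ∧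
    ∫ r in Set.Ioi a, ((r / a : ℝ) : ℂ) ^ k * (h r : ℂ) / (r : ℂ)
      = b * ∫ t in Set.Ioi (0:ℝ), Complex.exp (b * k * t) * (H t : ℂ) := by
  have hder : ∀ t ∈ Set.Ioi (0:ℝ), HasDerivWithinAt (fun t => a * Real.exp (b * t))
      (a * (Real.exp (b * t) * b)) (Set.Ioi 0) t := fun t _ => by
    have := (((hasDerivAt_id t).const_mul b).exp.const_mul a).hasDerivWithinAt (s := Set.Ioi 0)
    simpa using this
  have hinj : Set.InjOn (fun t => a * Real.exp (b * t)) (Set.Ioi 0) := by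
    intro s _ t _ hst
    exact mul_left_cancel₀ hb.ne' (Real.exp_injective (mul_left_cancel₀ ha.ne' hst))
  have himg : (fun t => a * Real.exp (b * t)) '' Set.Ioi 0 = Set.Ioi a := by
    ext r
    constructor
    · rintro ⟨t, ht, rfl⟩
      have : 1 < Real.exp (b * t) := Real.one_lt_exp_iff.2 (mul_pos hb ht)
      exact lt_mul_of_one_lt_right ha this
    · intro hr
      have hr : a < r := hr
      have h1 : 1 < r / a := (one_lt_div ha).2 hr
      refine ⟨Real.log (r / a) / b, div_pos (Real.log_pos h1) hb, ?_⟩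
      simp only
      rw [mul_div_cancel₀ _ hb.ne', Real.exp_log (by linarith), mul_div_cancel₀ _ ha.ne']
  have hcongr : ∀ᵐ t ∂(volume.restrict (Set.Ioi (0:ℝ))),
      |a * (Real.exp (b * t) * b)| • (((a * Real.exp (b * t) / a : ℝ) : ℂ) ^ k
        * (h (a * Real.exp (b * t)) : ℂ) / ((a * Real.exp (b * t) : ℝ) : ℂ))
      = b * (Complex.exp (b * k * t) * (H t : ℂ)) := by
    rw [ae_restrict_iff' measurableSet_Ioi]
    filter_upwards [hH] with t ht hmem
    have hpos := Real.exp_pos (b * t)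
    rw [ht hmem, abs_of_pos (by positivity), mul_div_cancel_left₀ _ ha.ne',
      Complex.cpow_def_of_ne_zero (Complex.ofReal_ne_zero.2 hpos.ne'), ← Complex.ofReal_log hpos.le,
      Real.log_exp, Complex.real_smul]
    have e : ((b * t : ℝ) : ℂ) * k = b * k * t := by push_cast; ring
    have h1 : (a : ℂ) ≠ 0 := Complex.ofReal_ne_zero.2 ha.ne'
    have h2 : ((Real.exp (b * t) : ℝ) : ℂ) ≠ 0 := Complex.ofReal_ne_zero.2 hpos.ne'
    rw [e, Complex.ofReal_mul a, Complex.ofReal_mul, Complex.ofReal_mul]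
    field_simp
  constructor
  · rw [← himg, integrableOn_image_iff_integrableOn_abs_deriv_smul measurableSet_Ioi hder hinj]
    exact (hint.const_mul (b : ℂ)).congr (hcongr.mono fun _ ht => ht.symm)
  · rw [← himg, integral_image_eq_integral_abs_deriv_smul measurableSet_Ioi hder hinj,
      integral_congr_ae hcongr, integral_const_mul]

lemma wedgeR_mul_exp {a α : ℝ} (ha : 0 < a) (hα : 0 < α) (t : ℝ) :
    wedgeR a α (a * Real.exp (2 * α / Real.pi * t)) = 2 * Real.cosh t := by
  have hpi := Real.pi_pos
  rw [wedgeR, mul_div_cancel_left₀ _ ha.ne', ← Real.exp_mul, ← Real.exp_mul, Real.cosh_eq]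
  have e : 2 * α / Real.pi * t * (Real.pi / (2 * α)) = t := by field_simp
  rw [mul_neg, e]
  ring

/-- The nonvanishing hypotheses matter: with `x / 0 = 0` and `log 0 = 0` the two sides may differ at
a zero. -/
lemma log_abs_div_cosh {c t : ℝ} (h1 : Real.cosh t + c ≠ 0) (h2 : Real.cosh t - c ≠ 0) :
    Real.log |(2 * Real.cosh t + 2 * c) / (2 * Real.cosh t - 2 * c)| = coshLogDiff c t := by
  rw [← mul_add, ← mul_sub, mul_div_mul_left _ _ two_ne_zero, abs_div,
    Real.log_div (abs_ne_zero.2 h1) (abs_ne_zero.2 h2), coshLogDiff]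

theorem proposition4p2 (a α : ℝ) (ha : 0 < a) (ha' : a < 2 * Real.pi)
    (hα : Real.pi / 2 < α) (hα' : α ≤ Real.pi)
    (k : ℂ) (hκ : -1 < (kappaOf α k).re) :
    (∀ φ : ℝ, -α < φ → φ < α →
      IntervalIntegrable (F3ArcIntegrand α φ k) MeasureTheory.volume (-α) α ∧
      MeasureTheory.IntegrableOn (F3RayIntegrand a α φ k) (Set.Ioi a) ∧
      F3 a α φ k = 0) ∧
    (∀ ρ : ℝ, a < ρ →
      IntervalIntegrable (F4ArcIntegrand a α ρ k) MeasureTheory.volume (-α) α ∧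
      MeasureTheory.IntegrableOn (F4RayIntegrand a α ρ k) (Set.Ioi a) ∧
      F4 a α ρ k = 0) := by
  have hpi := Real.pi_pos
  have hα0 : 0 < α := by linarith
  set b : ℝ := 2 * α / Real.pi with hb
  have hb0 : 0 < b := by positivity
  have hl : ((b : ℂ) * k).re < 1 := by
    have : kappaOf α k = -((b : ℂ) * k) := by rw [kappaOf, hb, neg_mul]
    rw [this, Complex.neg_re] at hκ
    linarith
  have hαk : (α : ℂ) * k = b * k * (Real.pi / 2) := by
    have : α = b * (Real.pi / 2) := by rw [hb]; field_simp
    rw [this]; push_cast; ring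
  constructor
  · intro φ hφ1 hφ2
    set y : ℝ := Real.pi * φ / (2 * α) with hy
    have hφ : φ = b * y := by rw [hb, hy]; field_simp
    have hy1 : -(Real.pi / 2) < y := by
      rw [hy, lt_div_iff₀ (by positivity)]; nlinarith
    have hy2 : y < Real.pi / 2 := by
      rw [hy, div_lt_iff₀ (by positivity)]; nlinarith
    obtain ⟨hi, hr⟩ := mellin_tail_substitution ha hb0 k
      (h := fun r => Real.log |(wedgeR a α r + 2 * Real.sin y) / (wedgeR a α r - 2 * Real.sin y)|)
      (H := coshLogDiff (Real.sin y))
      (ae_of_all _ fun t ht => by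
        have hc := Real.one_lt_cosh.2 ht.ne'
        rw [hb, wedgeR_mul_exp ha hα0]
        exact log_abs_div_cosh (by linarith [Real.neg_one_le_sin y])
          (by linarith [Real.sin_le_one y]))
      (integrableOn_exp_mul_coshLogDiff hl _)
    refine ⟨intervalIntegrable_arc α _ k, hi, ?_⟩
    have harc := integral_arc hα0 (Real.sin y) k
    have hs := strip_identity_sin hl hy1.le hy2.le
    have hkφ : k * (φ : ℂ) = b * k * y := by rw [hφ]; push_cast; ring
    unfold F3 F3ArcIntegrand F3RayIntegrand
    rw [harc, hr, hαk, hkφ]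
    linear_combination hs
  · intro ρ hρ
    have hρa : 1 < ρ / a := (one_lt_div ha).2 hρ
    set s : ℝ := Real.log (ρ / a) / b with hs
    have hs0 : 0 < s := div_pos (Real.log_pos hρa) hb0
    have hρs : ρ = a * Real.exp (b * s) := by
      rw [hs, mul_div_cancel₀ _ hb0.ne', Real.exp_log (by linarith), mul_div_cancel₀ _ ha.ne']
    have hR : wedgeR a α ρ = 2 * Real.cosh s := by rw [hρs, hb, wedgeR_mul_exp ha hα0]
    have hne : ∀ᵐ x : ℝ, x ≠ s := by simp [ae_iff, measure_singleton]
    obtain ⟨hi, hr⟩ := mellin_tail_substitution ha hb0 k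
      (h := fun r => Real.log |(wedgeR a α r - wedgeR a α ρ) / (wedgeR a α r + wedgeR a α ρ)|)
      -- The quotient in `F4` is inverted, hence the sign; the singular point `t = s` is discarded
      -- as a null set.
      (H := fun t => -coshLogDiff (Real.cosh s) t)
      (by
        filter_upwards [hne] with t ht ht0
        have hc : Real.cosh t ≠ Real.cosh s := fun h =>
          ht (Real.cosh_strictMonoOn.injOn (Set.mem_Ici.2 ht0.le) (Set.mem_Ici.2 hs0.le) h)
        rw [hb, wedgeR_mul_exp ha hα0, hR, ← log_abs_div_cosh
          (by linarith [Real.cosh_pos t, Real.cosh_pos s]) (sub_ne_zero.2 hc), ← Real.log_inv,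
          ← abs_inv, inv_div])
      (by
        simp only [Complex.ofReal_neg, mul_neg]
        exact (integrableOn_exp_mul_coshLogDiff hl (Real.cosh s)).neg)
    refine ⟨intervalIntegrable_arc α _ k, hi, ?_⟩
    have harc := integral_arc hα0 (wedgeR a α ρ / 2) k
    have hR2 : wedgeR a α ρ / 2 = Real.cosh s := by rw [hR]; ring
    have hst := strip_identity_cosh hl hs0
    have hpow : ((ρ / a : ℝ) : ℂ) ^ k = Complex.exp (b * k * s) := by
      have : ρ / a = Real.exp (b * s) := by rw [hρs, mul_div_cancel_left₀ _ ha.ne']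
      rw [this, Complex.cpow_def_of_ne_zero (Complex.ofReal_ne_zero.2 (Real.exp_pos _).ne'),
        ← Complex.ofReal_log (Real.exp_pos _).le, Real.log_exp]
      push_cast; ring_nf
    simp only [Complex.ofReal_neg, mul_neg, integral_neg] at hr
    rw [hR2] at harc
    unfold F4 F4ArcIntegrand F4RayIntegrand
    rw [hr, hR2, harc, hαk, hpow]
    linear_combination -hst
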